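/- Let $(G,+)$ be a finite abelian group, let $k\ge 2$ be an integer and $\Sigma_k=\{0,\dots,k-1\}$. Let $f:\Sigma_k\times\Sigma_k\to G$ satisfy $f(0,0)=0$ and the difference condition: for all $i\ne j$ in $\Sigma_k$ and all $g\in G$, $$\#\{h\in\Sigma_k : f(i,h)-f(j,h)=g\}=\frac{k}{|G|}.$$ For $n\in\mathbb N=\{0,1,2,\dots\}$ write $n=\sum_{i\ge 0}x_i(n)k^i$ with digits $x_i(n)\in\Sigma_k$, only finitely many of them non-zero, and let $u=(u_n)_{n\ge0}$ be the generalised Rudin--Shapiro sequence $$u_n=\sum_{i\ge 0} f\bigl(x_i(n),x_{i+1}(n)\bigr)\in G .$$ Then every pattern has a frequency in $u$: for every $L\in\mathbb N$ and every word $w=w_0\cdots w_{L-1}\in G^L$ the limit $$\lim_{N\to\infty}\frac1N\,\#\{0\le n<N : u_{n+i}=w_i\text{ for all }0\le i<L\}$$ exists. Moreover, every element of $G$ has frequency $1/|G|$: for every $g\in G$, $$\lim_{N\to\infty}\frac1N\,\#\{0\le n<N : u_n=g\}=\frac1{|G|}.$$ -/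

import Mathlib

/-- The digit `x_i` (least significant digit first, padded by zeros) in the representation
`n = ∑ x_i k ^ i` of `n` in base `k`; a base is at least `2`. -/
def digit (k : ℕ) [NeZero k] (n i : ℕ) : Fin k :=
  Fin.ofNat k (n / k ^ i)

theorem digit_eq_zero {k : ℕ} [NeZero k] (hk : 2 ≤ k) {n i : ℕ} (h : n ≤ i) :
    digit k n i = 0 := by
  have h1 : n < k ^ i := lt_of_le_of_lt h (Nat.lt_pow_self (by omega))
  rw [digit, Nat.div_eq_of_lt h1]
  rfl

theorem sum_digit {k : ℕ} [NeZero k] (hk : 2 ≤ k) (n : ℕ) :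
    ∑ i ∈ Finset.range n, (digit k n i : ℕ) * k ^ i = n := by
  have key : ∀ m, ∑ i ∈ Finset.range m, (digit k n i : ℕ) * k ^ i = n % k ^ m := by
    intro m
    induction m with
    | zero => simp [Nat.mod_one]
    | succ m ih =>
      rw [Finset.sum_range_succ, ih, Nat.mod_pow_succ, mul_comm]
      rfl
  rw [key, Nat.mod_eq_of_lt (Nat.lt_pow_self (by omega))]

/-- `u` is the block-additive sequence (of rank 2) in base `k` of weight function `f`. -/
structure IsBlockAdditive {G : Type*} [AddCommGroup G] (k : ℕ) [NeZero k]
    (f : Fin k → Fin k → G) (u : ℕ → G) : Prop where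
  map_zero_zero : f 0 0 = 0
  eq_sum : ∀ n, u n = ∑ᶠ i : ℕ, f (digit k n i) (digit k n (i + 1))

/-- In base `k ≥ 2` the sum defining a block-additive sequence has finitely many nonzero terms. -/
theorem blockAdditive_support_finite {G : Type*} [AddCommGroup G] {k : ℕ} [NeZero k] (hk : 2 ≤ k)
    {f : Fin k → Fin k → G} (hf : f 0 0 = 0) (n : ℕ) :
    (Function.support fun i : ℕ => f (digit k n i) (digit k n (i + 1))).Finite := by
  refine (Set.finite_lt_nat n).subset fun i hi => ?_
  by_contra h
  have h' : n ≤ i := not_lt.mp h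
  exact hi (by simp [digit_eq_zero hk h', digit_eq_zero hk (Nat.le_succ_of_le h'), hf])

/-- The difference condition: for two distinct rows `i`, `j`, the difference
`d i h - d j h` takes each value `g` for exactly `k / |G|` columns `h` (an exact quotient). -/
def IsDifferenceMatrix {G : Type*} [AddCommGroup G] (k : ℕ) (d : Fin k → Fin k → G) : Prop :=
  ∀ i j : Fin k, i ≠ j → ∀ g : G,
    (Nat.card {h : Fin k // d i h - d j h = g} : ℚ) = (k : ℚ) / (Nat.card G : ℚ)

/-- `u` is a generalised Rudin–Shapiro sequence in base `k`. -/
def IsGeneralisedRudinShapiro {G : Type*} [AddCommGroup G] (k : ℕ) [NeZero k]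
    (u : ℕ → G) : Prop :=
  ∃ f : Fin k → Fin k → G, IsBlockAdditive k f u ∧ IsDifferenceMatrix k f

/-- The pattern `w` (a finite word of length `L`) occurs in `u` at position `n`. -/
def OccursAt {A : Type*} (u : ℕ → A) {L : ℕ} (w : Fin L → A) (n : ℕ) : Prop :=
  ∀ i : Fin L, u (n + i) = w i

open Classical in
/-- The pattern `w` has frequency `α` in `u`: the proportion of positions `n < N` at which `w`
occurs tends to `α` as `N → ∞`. -/
def HasFrequency {A : Type*} (u : ℕ → A) {L : ℕ} (w : Fin L → A) (α : ℝ) : Prop :=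
  Filter.Tendsto
    (fun N : ℕ => (((Finset.range N).filter fun n => OccursAt u w n).card : ℝ) / (N : ℝ))
    Filter.atTop (nhds α)

/-!
Read from the most significant digit, `u n` is computed by an automaton whose state consists of the
last digit read and the value reached so far. The values of `u` at the multiples of `k` are the
increments along closed walks at the digit `0`; as `G` is finite they form a subgroup `T`. Hence a
bounded number `r` of further digits leads from any `q` to an index with last digit `0` and value
`0`. So any two blocks of length `K ^ (t + 1)`, where `K = k ^ r`, contain sub-blocks of length
`K ^ t` on which `u` is the same, and a pattern of length `L` occurs equally often in these, up to
at most `L` positions at the ends. Comparing the other `K - 1` pairs of sub-blocks recursively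
bounds the discrepancy between blocks by `O (t (K - 1) ^ t) = o (K ^ t)`, so frequencies exist.

The blocks that follow an index with last digit `0` and value `g ∈ T` are translates by `g` of
initial blocks, so frequencies are invariant under translation by `T`. The difference condition
gives `T = G`, and the `|G|` equal letter frequencies add up to `1`.
-/

section BlockSum

open Finset Filter Topology

/-- The sum of `φ` over the `q`-th block of length `b`, i.e. over the indices in
`[b * q, b * (q + 1))`. -/
def blockSum {E : Type*} [AddCommMonoid E] (φ : ℕ → E) (b q : ℕ) : E :=
  ∑ s ∈ range b, φ (b * q + s)

/-- The sequence `φ` has (Cesàro) mean value `m`. -/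
def HasMean {E : Type*} [SeminormedAddCommGroup E] [NormedSpace ℝ E] (φ : ℕ → E) (m : E) : Prop :=
  Tendsto (fun N : ℕ => (N : ℝ)⁻¹ • ∑ n ∈ range N, φ n) atTop (𝓝 m)

theorem sum_range_mul_eq_sum_blockSum {E : Type*} [AddCommMonoid E] (φ : ℕ → E) (b Q : ℕ) :
    ∑ n ∈ range (b * Q), φ n = ∑ q ∈ range Q, blockSum φ b q := by
  induction Q with
  | zero => simp
  | succ Q ih => rw [Nat.mul_succ, sum_range_add, ih, sum_range_succ, blockSum]

theorem blockSum_mul {E : Type*} [AddCommMonoid E] (φ : ℕ → E) (b K q : ℕ) :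
    blockSum φ (b * K) q = ∑ j : Fin K, blockSum φ b (K * q + j) := by
  rw [blockSum, sum_range_mul_eq_sum_blockSum (fun s => φ (b * K * q + s)),
    Fin.sum_univ_eq_sum_range fun j => blockSum φ b (K * q + j)]
  simp only [blockSum, mul_add, mul_assoc, add_assoc]

section Norm

variable {E : Type*} [SeminormedAddCommGroup E] {φ ψ : ℕ → E} {b : ℕ} {C δ : ℝ}

theorem norm_sum_sub_sum_le_of_pair {ι : Type*} [Fintype ι] (F F' : ι → E) {B L : ℝ} (i j : ι)
    (hij : ‖F i - F' j‖ ≤ L) (hB : ∀ i j, ‖F i - F' j‖ ≤ B) :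
    ‖∑ i, F i - ∑ j, F' j‖ ≤ (Fintype.card ι - 1) * B + L := by
  classical
  rw [← Equiv.sum_comp (Equiv.swap i j) F', ← sum_sub_distrib,
    ← sum_erase_add _ _ (mem_univ i), Equiv.swap_apply_left]
  refine (norm_add_le _ _).trans (add_le_add ?_ hij)
  refine (norm_sum_le_of_le _ fun x _ => hB x (Equiv.swap i j x)).trans_eq ?_
  rw [sum_const, card_erase_of_mem (mem_univ i), card_univ, nsmul_eq_mul,
    Nat.cast_pred (Fintype.card_pos_iff.2 ⟨i⟩)]

theorem norm_blockSum_sub_le_of_eq_of_add_le {L q q' : ℕ} (hC : ∀ n n', ‖φ n - ψ n'‖ ≤ C)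
    (h : ∀ s, s + L ≤ b → φ (b * q + s) = ψ (b * q' + s)) :
    ‖blockSum φ b q - blockSum ψ b q'‖ ≤ L * C := by
  have htail : blockSum φ b q - blockSum ψ b q' =
      ∑ s ∈ Ico (b - L) b, (φ (b * q + s) - ψ (b * q' + s)) := by
    rw [blockSum, blockSum, ← sum_sub_distrib]
    refine (sum_subset (fun s hs => ?_) fun s hs hs' => ?_).symm
    · exact mem_range.2 (mem_Ico.1 hs).2
    · simp only [mem_range, mem_Ico, not_and, not_lt] at hs hs'
      rw [h s (by omega), sub_self]
  rw [htail]
  refine (norm_sum_le_of_le _ fun s _ => hC _ _).trans ?_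
  rw [sum_const, Nat.card_Ico, nsmul_eq_mul]
  have hC0 : 0 ≤ C := (norm_nonneg _).trans (hC 0 0)
  gcongr
  omega

/-- One pair of sub-blocks with close sums at each scale makes the relative discrepancy between
blocks shrink by the factor `(K - 1) / K` at each scale, up to the error `L`. -/
theorem norm_blockSum_pow_sub_le {K : ℕ} (hK : 2 ≤ K) {L : ℝ} (hC : ∀ n, ‖φ n‖ ≤ C)
    (hL : ∀ t q q', ∃ i j : Fin K,
      ‖blockSum φ (K ^ t) (K * q + i) - blockSum φ (K ^ t) (K * q' + j)‖ ≤ L) (t q q' : ℕ) :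
    ‖blockSum φ (K ^ t) q - blockSum φ (K ^ t) q'‖ ≤ (2 * C + t * L) * ((K : ℝ) - 1) ^ t := by
  induction t generalizing q q' with
  | zero =>
    simpa [blockSum, two_mul] using (norm_sub_le _ _).trans (add_le_add (hC q) (hC q'))
  | succ t ih =>
    obtain ⟨i, j, hij⟩ := hL t q q'
    have hL0 : 0 ≤ L := (norm_nonneg _).trans hij
    have hK1 : (1 : ℝ) ≤ (K : ℝ) - 1 := by
      have : (2 : ℝ) ≤ K := by exact_mod_cast hK
      linarith
    rw [pow_succ, blockSum_mul, blockSum_mul]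
    calc _ ≤ ((K : ℝ) - 1) * ((2 * C + t * L) * (K - 1) ^ t) + L * 1 := by
          simpa using norm_sum_sub_sum_le_of_pair _ _ i j hij fun i j =>
            ih (K * q + i) (K * q' + j)
      _ ≤ (K - 1) * ((2 * C + t * L) * (K - 1) ^ t) + L * (K - 1) ^ (t + 1) := by
          gcongr
          exact one_le_pow₀ hK1
      _ = _ := by push_cast; ring

variable [NormedSpace ℝ E] {m : E}

theorem norm_smul_sum_range_sub_smul_blockSum_le (hb : 0 < b) (hC : ∀ n, ‖φ n‖ ≤ C)
    (hδ : ∀ q q', ‖blockSum φ b q - blockSum φ b q'‖ ≤ δ) (q N : ℕ) :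
    ‖(b : ℝ) • ∑ n ∈ range N, φ n - (N : ℝ) • blockSum φ b q‖ ≤ N * δ + 2 * b ^ 2 * C := by
  have hrange (a n : ℕ) : ‖∑ s ∈ range n, φ (a + s)‖ ≤ n * C := by
    simpa using norm_sum_le_of_le (range n) fun s _ => hC (a + s)
  obtain ⟨Q, R, hR, rfl⟩ : ∃ Q R, R ≤ b ∧ N = b * Q + R :=
    ⟨N / b, N % b, (Nat.mod_lt _ hb).le, (Nat.div_add_mod N b).symm⟩
  have hblocks : ‖∑ j ∈ range Q, (blockSum φ b j - blockSum φ b q)‖ ≤ Q * δ := by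
    simpa using norm_sum_le_of_le (range Q) fun j _ => hδ j q
  have hδ0 : 0 ≤ δ := (norm_nonneg _).trans (hδ 0 0)
  have hC0 : 0 ≤ C := (norm_nonneg _).trans (hC 0)
  have hsplit : (b : ℝ) • ∑ n ∈ range (b * Q + R), φ n -
      ((b * Q + R : ℕ) : ℝ) • blockSum φ b q =
      (b : ℝ) • ∑ j ∈ range Q, (blockSum φ b j - blockSum φ b q) +
        ((b : ℝ) • ∑ s ∈ range R, φ (b * Q + s) - (R : ℝ) • blockSum φ b q) := by
    rw [sum_range_add, sum_range_mul_eq_sum_blockSum, sum_sub_distrib, sum_const, card_range,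
      ← Nat.cast_smul_eq_nsmul ℝ]
    push_cast
    module
  rw [hsplit]
  calc _ ≤ b * (Q * δ) + (b * (R * C) + R * (b * C)) := by
        refine norm_add_le_of_le ?_ (norm_sub_le_of_le ?_ ?_) <;>
          rw [norm_smul, Real.norm_natCast] <;> gcongr
        exacts [hrange _ _, hrange _ _]
    _ ≤ b * (Q * δ) + (b * (b * C) + b * (b * C)) := by gcongr
    _ ≤ ((b * Q + R : ℕ) : ℝ) * δ + 2 * b ^ 2 * C := by
        push_cast
        nlinarith [mul_nonneg R.cast_nonneg hδ0]

theorem norm_average_sub_average_blockSum_le (hb : 0 < b) (hC : ∀ n, ‖φ n‖ ≤ C)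
    (hδ : ∀ q q', ‖blockSum φ b q - blockSum φ b q'‖ ≤ δ) (q : ℕ) {N : ℕ} (hN : 0 < N) :
    ‖(N : ℝ)⁻¹ • ∑ n ∈ range N, φ n - (b : ℝ)⁻¹ • blockSum φ b q‖ ≤
      δ / b + 2 * b * C / N := by
  have : (0 : ℝ) < b := Nat.cast_pos.2 hb
  have : (0 : ℝ) < N := Nat.cast_pos.2 hN
  have hfactor : (N : ℝ)⁻¹ • ∑ n ∈ range N, φ n - (b : ℝ)⁻¹ • blockSum φ b q =
      ((N : ℝ) * b)⁻¹ • ((b : ℝ) • ∑ n ∈ range N, φ n - (N : ℝ) • blockSum φ b q) := by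
    rw [smul_sub, smul_smul, smul_smul]
    congr 2 <;> field_simp
  rw [hfactor, norm_smul, norm_inv, Real.norm_of_nonneg (by positivity)]
  calc _ ≤ ((N : ℝ) * b)⁻¹ * (N * δ + 2 * b ^ 2 * C) := by
        gcongr
        exact norm_smul_sum_range_sub_smul_blockSum_le hb hC hδ q N
    _ = δ / b + 2 * b * C / N := by field_simp

theorem exists_hasMean_of_norm_blockSum_sub_le [CompleteSpace E] (hC : ∀ n, ‖φ n‖ ≤ C)
    (h : ∀ ε > (0 : ℝ), ∃ b > 0, ∀ q q', ‖blockSum φ b q - blockSum φ b q'‖ ≤ ε * b) :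
    ∃ m, HasMean φ m := by
  refine cauchySeq_tendsto_of_complete (Metric.cauchySeq_iff'.2 fun ε hε => ?_)
  obtain ⟨b, hb, hclose⟩ := h (ε / 4) (by positivity)
  have hb' : (b : ℝ) ≠ 0 := Nat.cast_ne_zero.2 hb.ne'
  have herror : ∀ᶠ N : ℕ in atTop, 2 * b * C / N < ε / 4 :=
    (tendsto_const_div_atTop_nhds_zero_nat _).eventually_lt_const (by positivity)
  have hnear : ∀ᶠ N : ℕ in atTop,
      ‖(N : ℝ)⁻¹ • ∑ n ∈ range N, φ n - (b : ℝ)⁻¹ • blockSum φ b 0‖ < ε / 2 := by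
    filter_upwards [herror, eventually_gt_atTop 0] with N hN hN0
    have hle := norm_average_sub_average_blockSum_le hb hC hclose 0 hN0
    rw [mul_div_cancel_right₀ _ hb'] at hle
    linarith
  obtain ⟨M, hM⟩ := eventually_atTop.1 hnear
  refine ⟨M, fun N hN => (dist_triangle_right _ _ ((b : ℝ)⁻¹ • blockSum φ b 0)).trans_lt ?_⟩
  rw [dist_eq_norm, dist_eq_norm]
  linarith [hM N hN, hM M le_rfl]

theorem exists_hasMean_of_close_subblocks [CompleteSpace E] {K : ℕ} (hK : 2 ≤ K) {L : ℝ}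
    (hC : ∀ n, ‖φ n‖ ≤ C)
    (hL : ∀ t q q', ∃ i j : Fin K,
      ‖blockSum φ (K ^ t) (K * q + i) - blockSum φ (K ^ t) (K * q' + j)‖ ≤ L) :
    ∃ m, HasMean φ m := by
  refine exists_hasMean_of_norm_blockSum_sub_le hC fun ε hε => ?_
  have hK0 : (0 : ℝ) < K := Nat.cast_pos.2 (by omega)
  have hK1 : (1 : ℝ) ≤ K := Nat.one_le_cast.2 (by omega)
  set x : ℝ := (K - 1) / K with hx
  have hx0 : 0 ≤ x := div_nonneg (sub_nonneg.2 hK1) hK0.le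
  have hx1 : x < 1 := (div_lt_one hK0).2 (sub_one_lt _)
  have hlim : Tendsto (fun t : ℕ => 2 * C * x ^ t + L * (t * x ^ t)) atTop (𝓝 0) := by
    simpa using ((tendsto_pow_atTop_nhds_zero_of_lt_one hx0 hx1).const_mul (2 * C)).add
      ((tendsto_self_mul_const_pow_of_lt_one hx0 hx1).const_mul L)
  obtain ⟨t, ht⟩ := (hlim.eventually_lt_const hε).exists
  refine ⟨K ^ t, pow_pos (by omega) t, fun q q' => ?_⟩
  calc _ ≤ (2 * C + t * L) * ((K : ℝ) - 1) ^ t := norm_blockSum_pow_sub_le hK hC hL t q q'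
    _ = (2 * C * x ^ t + L * (t * x ^ t)) * (K : ℝ) ^ t := by
        rw [hx, div_pow]
        field_simp
    _ ≤ ε * (K ^ t : ℕ) := by
        push_cast
        gcongr

theorem HasMean.tendsto_average_blockSum (h : HasMean φ m) (q : ℕ) :
    Tendsto (fun b : ℕ => (b : ℝ)⁻¹ • blockSum φ b q) atTop (𝓝 m) := by
  have hinit (Q : ℕ) :
      Tendsto (fun b : ℕ => (b : ℝ)⁻¹ • ∑ n ∈ range (b * Q), φ n) atTop (𝓝 ((Q : ℝ) • m)) := by
    rcases Q.eq_zero_or_pos with rfl | hQ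
    · simpa using tendsto_const_nhds
    · have hQ' : (Q : ℝ) ≠ 0 := Nat.cast_ne_zero.2 hQ.ne'
      refine ((h.comp (tendsto_id.atTop_mul_const' hQ)).const_smul (Q : ℝ)).congr fun b => ?_
      simp only [Function.comp_apply, id_eq, smul_smul, Nat.cast_mul, mul_inv]
      congr 1
      field_simp
  have hdiff := (hinit (q + 1)).sub (hinit q)
  rw [← sub_smul, Nat.cast_succ, add_sub_cancel_left, one_smul] at hdiff
  refine hdiff.congr fun b => ?_
  rw [← smul_sub, sum_range_mul_eq_sum_blockSum, sum_range_mul_eq_sum_blockSum, sum_range_succ,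
    add_sub_cancel_left]

end Norm

theorem HasMean.eq_of_norm_blockSum_sub_le {E : Type*} [NormedAddCommGroup E] [NormedSpace ℝ E]
    {φ ψ : ℕ → E} {m m' : E} {L : ℝ} (hφ : HasMean φ m) (hψ : HasMean ψ m') {b : ℕ → ℕ}
    (hb : Tendsto b atTop atTop) {q q' : ℕ}
    (hL : ∀ t, ‖blockSum φ (b t) q - blockSum ψ (b t) q'‖ ≤ L) : m = m' := by
  have hsub := ((hφ.tendsto_average_blockSum q).sub (hψ.tendsto_average_blockSum q')).comp hb
  have hzero : Tendsto (fun t => (b t : ℝ)⁻¹ • (blockSum φ (b t) q - blockSum ψ (b t) q')) atTop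
      (𝓝 0) := by
    refine squeeze_zero_norm (fun t => ?_)
      ((tendsto_const_div_atTop_nhds_zero_nat L).comp hb)
    rw [norm_smul, norm_inv, Real.norm_natCast, inv_mul_eq_div]
    exact div_le_div_of_nonneg_right (hL t) (b t).cast_nonneg
  simp only [smul_sub] at hzero
  exact sub_eq_zero.1 (tendsto_nhds_unique hsub hzero)

end BlockSum

section Pattern

variable {A : Type*} {u : ℕ → A} {L : ℕ} {w : Fin L → A}

/-- The indicator sequence of the positions at which `w` occurs in `u`; its mean value is the
frequency of `w`. -/
noncomputable def occurrenceIndicator (u : ℕ → A) (w : Fin L → A) : ℕ → ℝ :=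
  {n | OccursAt u w n}.indicator 1

theorem norm_occurrenceIndicator_le_one (n : ℕ) : ‖occurrenceIndicator u w n‖ ≤ 1 := by
  simpa [occurrenceIndicator] using norm_indicator_le_norm_self (1 : ℕ → ℝ) n

theorem norm_occurrenceIndicator_sub_le_one {L' : ℕ} {w' : Fin L' → A} (n n' : ℕ) :
    ‖occurrenceIndicator u w n - occurrenceIndicator u w' n'‖ ≤ 1 := by
  classical
  simp only [occurrenceIndicator, Set.indicator_apply]
  split_ifs <;> simp

theorem hasFrequency_iff_hasMean {α : ℝ} :
    HasFrequency u w α ↔ HasMean (occurrenceIndicator u w) α := by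
  classical
  simp only [HasFrequency, HasMean, occurrenceIndicator, Set.indicator_apply, Set.mem_ofPred_eq,
    Pi.one_apply, Finset.sum_boole, smul_eq_mul, inv_mul_eq_div]

theorem sum_eq_one_of_hasFrequency_letter [Fintype A] {α : A → ℝ}
    (h : ∀ a, HasFrequency u (fun _ : Fin 1 => a) (α a)) : ∑ a, α a = 1 := by
  classical
  have hpoint (n : ℕ) : ∑ a, occurrenceIndicator u (fun _ : Fin 1 => a) n = 1 := by
    simp [occurrenceIndicator, Set.indicator_apply, OccursAt]
  refine tendsto_nhds_unique
    (tendsto_finsetSum Finset.univ fun a _ => hasFrequency_iff_hasMean.1 (h a)) ?_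
  refine tendsto_const_nhds.congr' ?_
  filter_upwards [Filter.eventually_ne_atTop 0] with N hN
  rw [← Finset.smul_sum, Finset.sum_comm]
  simp [hpoint, hN]

end Pattern

section Digit

variable {k : ℕ} [NeZero k]

theorem digit_zero_eq_of_modEq {n n' : ℕ} (h : n ≡ n' [MOD k]) : digit k n 0 = digit k n' 0 :=
  Fin.ext (by simpa [digit, Nat.ModEq] using h)

theorem digit_mul_add_zero (n : ℕ) (a : Fin k) : digit k (k * n + a) 0 = a := by
  ext
  simp [digit, Nat.mod_eq_of_lt a.isLt]

theorem digit_mul_add_succ (n : ℕ) (a : Fin k) (i : ℕ) :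
    digit k (k * n + a) (i + 1) = digit k n i := by
  rw [digit, digit, pow_succ', ← Nat.div_div_eq_div_mul, Nat.mul_add_div (NeZero.pos k),
    Nat.div_eq_of_lt a.isLt, add_zero]

end Digit

theorem IsDifferenceMatrix.surjective_sub {G : Type*} [AddCommGroup G] [Finite G] {k : ℕ}
    {d : Fin k → Fin k → G} (hd : IsDifferenceMatrix k d) {i j : Fin k} (hij : i ≠ j) :
    Function.Surjective fun h => d i h - d j h := by
  intro g
  have hpos : (0 : ℚ) < Nat.card {h : Fin k // d i h - d j h = g} := by
    rw [hd i j hij g]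
    exact div_pos (Nat.cast_pos.2 i.pos) (Nat.cast_pos.2 Nat.card_pos)
  obtain ⟨⟨h, hh⟩⟩ := (Nat.card_pos_iff.1 (Nat.cast_pos.1 hpos)).1
  exact ⟨h, hh⟩

namespace IsBlockAdditive

open Filter

variable {G : Type*} [AddCommGroup G] {k : ℕ} [NeZero k] {f : Fin k → Fin k → G} {u : ℕ → G}

theorem eq_sum_range (hu : IsBlockAdditive k f u) (hk : 2 ≤ k) {n M : ℕ} (h : n ≤ M) :
    u n = ∑ i ∈ Finset.range M, f (digit k n i) (digit k n (i + 1)) := by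
  rw [hu.eq_sum n]
  refine finsum_eq_sum_of_support_subset _ fun i hi => ?_
  by_contra hM
  have hni : n ≤ i := h.trans (by simpa using hM)
  exact hi (by simp [digit_eq_zero hk hni, digit_eq_zero hk (Nat.le_succ_of_le hni),
    hu.map_zero_zero])

theorem apply_zero (hu : IsBlockAdditive k f u) (hk : 2 ≤ k) : u 0 = 0 :=
  hu.eq_sum_range hk le_rfl

theorem apply_mul_add (hu : IsBlockAdditive k f u) (hk : 2 ≤ k) (n : ℕ) (a : Fin k) :
    u (k * n + a) = f a (digit k n 0) + u n := by
  have hn : n ≤ k * n + a := (Nat.le_mul_of_pos_left n (NeZero.pos k)).trans (Nat.le_add_right _ _)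
  rw [hu.eq_sum_range hk (Nat.le_succ (k * n + a)), Finset.sum_range_succ', add_comm,
    hu.eq_sum_range hk hn]
  simp only [digit_mul_add_zero, digit_mul_add_succ, zero_add]

theorem apply_pow_mul_add_sub (hu : IsBlockAdditive k f u) (hk : 2 ≤ k) {q q' : ℕ}
    (hq : q ≡ q' [MOD k]) (m : ℕ) {s : ℕ} (hs : s < k ^ m) :
    u (k ^ m * q + s) - u q = u (k ^ m * q' + s) - u q' := by
  induction m generalizing s with
  | zero =>
    obtain rfl : s = 0 := by simpa using hs
    simp
  | succ m ih =>
    have hs' : s / k < k ^ m := Nat.div_lt_of_lt_mul (by rwa [pow_succ'] at hs)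
    have hsplit : ∀ x, k ^ (m + 1) * x + s = k * (k ^ m * x + s / k) + Fin.ofNat k s := by
      intro x
      conv_lhs => rw [← Nat.div_add_mod s k]
      rw [Fin.val_ofNat]
      ring
    have hlast : digit k (k ^ m * q + s / k) 0 = digit k (k ^ m * q' + s / k) 0 :=
      digit_zero_eq_of_modEq ((hq.mul_left _).add_right _)
    rw [hsplit, hsplit, hu.apply_mul_add hk, hu.apply_mul_add hk, hlast, add_sub_assoc, ih hs',
      add_sub_assoc]

theorem apply_pow_mul_add_of_dvd (hu : IsBlockAdditive k f u) (hk : 2 ≤ k) {q : ℕ}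
    (hq : k ∣ q) (m : ℕ) {s : ℕ} (hs : s < k ^ m) :
    u (k ^ m * q + s) = u q + u s := by
  have h := hu.apply_pow_mul_add_sub hk (Nat.modEq_zero_iff_dvd.2 hq) m hs
  rw [mul_zero, zero_add, hu.apply_zero hk, sub_zero] at h
  rw [← h, add_sub_cancel]

/-- The values of `u` at the multiples of `k`. They are the increments of `u` along the closed
walks at the digit `0`, which is why they form a group. -/
def multipleValues [Finite G] (hu : IsBlockAdditive k f u) (hk : 2 ≤ k) : AddSubgroup G :=
  let values : AddSubmonoid G :=
    { carrier := Set.range fun n => u (k * n)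
      zero_mem' := ⟨0, hu.apply_zero hk⟩
      add_mem' := by
        rintro _ _ ⟨m, rfl⟩ ⟨n, rfl⟩
        have hlt : k * n < k ^ (k * n + 1) := (Nat.lt_succ_self _).trans (Nat.lt_pow_self hk)
        refine ⟨k ^ (k * n) * (k * m) + n, ?_⟩
        rw [← hu.apply_pow_mul_add_of_dvd hk (dvd_mul_right k m) _ hlt]
        ring_nf }
  { values with
    neg_mem' := fun {g} hg => AddSubmonoid.multiples_le.2 hg
      (mem_multiples_iff_mem_zmultiples.2 (neg_mem (AddSubgroup.mem_zmultiples g))) }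

theorem multipleValues_eq_top [Finite G] (hu : IsBlockAdditive k f u) (hk : 2 ≤ k) {i j : Fin k}
    (hij : Function.Surjective fun h => f i h - f j h) : hu.multipleValues hk = ⊤ := by
  have hdigits (a b : Fin k) : f a 0 + f b a + f 0 b ∈ hu.multipleValues hk := by
    refine ⟨k * (k * 0 + a) + b, ?_⟩
    have hlast := hu.apply_mul_add hk (k * (k * 0 + a) + b) 0
    rw [Fin.val_zero, add_zero, digit_mul_add_zero] at hlast
    change u _ = _
    rw [hlast, hu.apply_mul_add hk _ b, hu.apply_mul_add hk 0 a, hu.apply_zero hk,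
      digit_mul_add_zero, digit_eq_zero hk le_rfl]
    abel
  have hdiff (h : Fin k) : f i h - f j h - (f i 0 - f j 0) ∈ hu.multipleValues hk := by
    convert sub_mem (sub_mem (hdigits h i) (hdigits h j))
      (sub_mem (hdigits i 0) (hdigits j 0)) using 1
    abel
  rw [eq_top_iff]
  intro g _
  obtain ⟨h, hh⟩ := hij (g + (f i 0 - f j 0))
  simpa [hh] using hdiff h

theorem surjective_apply_mul_of_isDifferenceMatrix [Finite G] (hu : IsBlockAdditive k f u)
    (hk : 2 ≤ k) (hf : IsDifferenceMatrix k f) : Function.Surjective fun n => u (k * n) := by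
  have h01 : (⟨1, hk⟩ : Fin k) ≠ 0 := by simp [Fin.ext_iff]
  exact fun g => (hu.multipleValues_eq_top hk (hf.surjective_sub h01)).ge (AddSubgroup.mem_top g)

/-- Such an index is synchronizing: `u` restricted to the blocks that follow it looks as it does on
initial blocks. -/
theorem exists_pow_forall_exists_apply_eq_zero [Finite G] (hu : IsBlockAdditive k f u)
    (hk : 2 ≤ k) :
    ∃ r ≠ 0, ∀ q, ∃ s : Fin (k ^ r), k ∣ k ^ r * q + s ∧ u (k ^ r * q + s) = 0 := by
  have hneg : ∀ᶠ r in atTop, ∀ g ∈ hu.multipleValues hk,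
      ∃ n, k * n < k ^ r ∧ u (k * n) = -g := by
    refine eventually_all.2 fun g => ?_
    by_cases hg : g ∈ hu.multipleValues hk
    · obtain ⟨n, hn⟩ := neg_mem hg
      filter_upwards [eventually_ge_atTop (k * n)] with r hr _
      exact ⟨n, hr.trans_lt (Nat.lt_pow_self hk), hn⟩
    · exact Eventually.of_forall fun _ h => absurd h hg
  obtain ⟨r, hr⟩ := hneg.exists
  refine ⟨r + 1, r.succ_ne_zero, fun q => ?_⟩
  obtain ⟨n, hn, hun⟩ := hr (u (k * q)) ⟨q, rfl⟩
  have hindex : k ^ (r + 1) * q + k * n = k ^ r * (k * q) + k * n := by ring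
  refine ⟨⟨k * n, hn.trans (Nat.pow_lt_pow_succ hk)⟩, ?_, ?_⟩
  · exact ((dvd_pow_self k r.succ_ne_zero).mul_right q).add (dvd_mul_right k n)
  · rw [hindex, hu.apply_pow_mul_add_of_dvd hk (dvd_mul_right k q) r hn, hun, add_neg_cancel]

theorem occursAt_pow_mul_add_iff (hu : IsBlockAdditive k f u) (hk : 2 ≤ k) {L : ℕ}
    (w : Fin L → G) {q q' : ℕ} (hq : q ≡ q' [MOD k]) {c : G} (hc : u q' = u q + c) {m s : ℕ}
    (hs : s + L ≤ k ^ m) :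
    OccursAt u w (k ^ m * q + s) ↔ OccursAt u (fun i => w i + c) (k ^ m * q' + s) := by
  refine forall_congr' fun i => ?_
  have hshift : u (k ^ m * q' + s + i) = u (k ^ m * q + s + i) + c := by
    have hi := hu.apply_pow_mul_add_sub hk hq m (s := s + i) (by omega)
    rw [hc, ← add_assoc, ← add_assoc] at hi
    grind
  rw [hshift, add_left_inj]

theorem norm_blockSum_occurrenceIndicator_sub_le (hu : IsBlockAdditive k f u) (hk : 2 ≤ k) {L : ℕ}
    (w : Fin L → G) {q q' : ℕ} (hq : q ≡ q' [MOD k]) {c : G} (hc : u q' = u q + c) (m : ℕ) :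
    ‖blockSum (occurrenceIndicator u w) (k ^ m) q -
      blockSum (occurrenceIndicator u fun i => w i + c) (k ^ m) q'‖ ≤ L := by
  rw [← mul_one (L : ℝ)]
  refine norm_blockSum_sub_le_of_eq_of_add_le norm_occurrenceIndicator_sub_le_one fun s hs => ?_
  classical
  simp only [occurrenceIndicator, Set.indicator_apply, Set.mem_ofPred_eq,
    Pi.one_apply, hu.occursAt_pow_mul_add_iff hk w hq hc hs]

theorem exists_hasFrequency [Finite G] (hu : IsBlockAdditive k f u) (hk : 2 ≤ k) {L : ℕ}
    (w : Fin L → G) : ∃ α, HasFrequency u w α := by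
  obtain ⟨r, hr0, hr⟩ := hu.exists_pow_forall_exists_apply_eq_zero hk
  simp only [hasFrequency_iff_hasMean]
  refine exists_hasMean_of_close_subblocks (hk.trans (Nat.le_self_pow hr0 k)) (L := L)
    norm_occurrenceIndicator_le_one fun t q q' => ?_
  obtain ⟨s, hs, hus⟩ := hr q
  obtain ⟨s', hs', hus'⟩ := hr q'
  refine ⟨s, s', ?_⟩
  have hmod : k ^ r * q + s ≡ k ^ r * q' + s' [MOD k] :=
    (Nat.modEq_zero_iff_dvd.2 hs).trans (Nat.modEq_zero_iff_dvd.2 hs').symm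
  simpa [← pow_mul] using
    hu.norm_blockSum_occurrenceIndicator_sub_le hk w hmod (c := 0) (by simp [hus, hus']) (r * t)

theorem hasFrequency_add_apply_mul [Finite G] (hu : IsBlockAdditive k f u) (hk : 2 ≤ k) {L : ℕ}
    {w : Fin L → G} {α : ℝ} (hα : HasFrequency u w α) (n : ℕ) :
    HasFrequency u (fun i => w i + u (k * n)) α := by
  set w' : Fin L → G := fun i => w i + u (k * n)
  obtain ⟨β, hβ⟩ := hu.exists_hasFrequency hk w'
  have hmod : 0 ≡ k * n [MOD k] := (Nat.modEq_zero_iff_dvd.2 (dvd_mul_right k n)).symm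
  have hαβ : α = β := (hasFrequency_iff_hasMean.1 hα).eq_of_norm_blockSum_sub_le
    (hasFrequency_iff_hasMean.1 hβ) (tendsto_pow_atTop_atTop_of_one_lt hk)
    (hu.norm_blockSum_occurrenceIndicator_sub_le hk w hmod (by simp [hu.apply_zero hk]))
  exact hαβ ▸ hβ

theorem hasFrequency_letter [Finite G] (hu : IsBlockAdditive k f u) (hk : 2 ≤ k)
    (hsurj : Function.Surjective fun n => u (k * n)) (g : G) :
    HasFrequency u (fun _ : Fin 1 => g) (1 / (Nat.card G : ℝ)) := by
  have := Fintype.ofFinite G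
  obtain ⟨α, hα⟩ := hu.exists_hasFrequency hk fun _ : Fin 1 => (0 : G)
  have hall (h : G) : HasFrequency u (fun _ : Fin 1 => h) α := by
    obtain ⟨n, rfl⟩ := hsurj h
    simpa using hu.hasFrequency_add_apply_mul hk hα n
  have hsum := sum_eq_one_of_hasFrequency_letter hall
  rw [Finset.sum_const, Finset.card_univ, nsmul_eq_mul, ← Nat.card_eq_fintype_card] at hsum
  rw [← eq_one_div_of_mul_eq_one_right hsum]
  exact hall g

end IsBlockAdditive

theorem mainTheorem6_general {G : Type*} [AddCommGroup G] [Finite G] {k : ℕ} [NeZero k]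
    (hk : 2 ≤ k) {f : Fin k → Fin k → G} {u : ℕ → G} (hu : IsBlockAdditive k f u) :
    (∀ (L : ℕ) (w : Fin L → G), ∃ α : ℝ, HasFrequency u w α) ∧
      ((Function.Surjective fun n => u (k * n)) →
        ∀ g : G, HasFrequency u (fun _ : Fin 1 => g) (1 / (Nat.card G : ℝ))) :=
  ⟨fun _ w => hu.exists_hasFrequency hk w, hu.hasFrequency_letter hk⟩

theorem mainTheorem6 {G : Type*} [AddCommGroup G] [Finite G] (k : ℕ) [NeZero k] (hk : 2 ≤ k)
    (u : ℕ → G) (hu : IsGeneralisedRudinShapiro k u) :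
    (∀ (L : ℕ) (w : Fin L → G), ∃ α : ℝ, HasFrequency u w α) ∧
      ∀ g : G, HasFrequency u (fun _ : Fin 1 => g) (1 / (Nat.card G : ℝ)) := by
  obtain ⟨f, hu, hf⟩ := hu
  exact (mainTheorem6_general hk hu).imp_right fun h =>
    h (hu.surjective_apply_mul_of_isDifferenceMatrix hk hf)
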